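/- **Setting.** Let $(M,g)$ be a connected, paracompact, Hausdorff, smooth Riemannian manifold of dimension $n$, possibly with boundary, let $G$ be a unimodular Lie group acting smoothly and by isometries on $M$, and let $$M_0=\{x\in M:\ G\cdot x\neq\{x\}\}\setminus\partial M .$$ Let $\tilde\Sigma$ be an immersed connected submanifold of $M$ of dimension $1$, possibly with boundary, and let $\Sigma=\tilde\Sigma\cap M_0$. Assume that * $T_xM=T_x\tilde\Sigma\oplus T_x(G\cdot x)$ for every $x\in\Sigma$; * $M_0$ is open in $M$, $\Sigma$ is open in $\tilde\Sigma$ and connected, and every orbit in $M_0$ meets $\Sigma$, i.e. $M_0=G\cdot\Sigma$; * for $x\in\Sigma$ the orbit $G\cdot x$ has finite Riemannian ($(n-1)$-dimensional) measure $A(x)$, and $A$ is smooth on $\Sigma$. Let $\Delta_M$ be the Laplace–Beltrami operator, in local coordinates $\Delta_Mu=\bar g^{-1/2}\sum_k\partial_k\big(\sum_i g^{ik}\bar g^{1/2}\,\partial_iu\big)$ with $\bar g=\det(g_{ij})$. Given $f$, a *$C^2$ maximal radial solution* is a $G$-invariant function $u\in C^2(M_0)$ with $$-\Delta_Mu+f(x,u(x))=0\quad\text{in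 }M_0 .$$ For $D\subseteq M\times\mathbb R$, call $f$ *locally Lipschitz in the second variable on $D$* if for every compact $K\subseteq D$ there is $C_K>0$ with $|f(x,y_1)-f(x,y_2)|\le C_K|y_1-y_2|$ for all $(x,y_1),(x,y_2)\in K$; call $f$ *radial in the first variable* if $f(g\cdot x,y)=f(x,y)$ for all $g\in G$ and all $(x,y)$ in its domain. **Theorem.** (i) Let $f\in C(M\times\mathbb R)$ be radial in the first variable and locally Lipschitz in the second variable on $M\times\mathbb R$. If $u_1,u_2$ are $C^2$ maximal radial solutions and there is $p\in\Sigma$ with $u_1(p)=u_2(p)$ and $\nabla u_1(p)=\nabla u_2(p)$, then $u_1\equiv u_2$ in $M_0$. (ii) Let $f$ be as in (i) and suppose moreover that $f(\cdot,0)=0$. If $u$ is a $C^2$ maximal radial solution and there is $p\in\Sigma$ with $u(p)=0$ and $\nabla u(p)=0$, then $u\equiv0$ in $M_0$. (iii) Let $f\in C(M\times(0,\infty))$ be radial in the first variable and locally Lipschitz in the second variable on $M\times(0,\infty)$. If $u_1,u_2$ are $C^2$ maximal radial solutions with $u_1,u_2>0$ in $M_0$ and there is $p\in\Sigma$ with $u_1(p)=u_2(p)$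 and $\nabla u_1(p)=\nabla u_2(p)$, then $u_1\equiv u_2$ in $M_0$. -/

import Mathlib

open Set MeasureTheory Manifold Bundle
open scoped ContDiff Topology

noncomputable section

namespace PolarPDE

/-! ### Analytic conditions on the nonlinearity -/

/-- `f` is locally Lipschitz in its second variable on `D ⊆ X × ℝ`: on every compact `K ⊆ D`,
`|f (x, y₁) - f (x, y₂)| ≤ C_K |y₁ - y₂|` whenever `(x, y₁)` and `(x, y₂)` lie in `K`. -/
def LocallyLipschitzInSnd {X : Type*} [TopologicalSpace X] (f : X → ℝ → ℝ) (D : Set (X × ℝ)) :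
    Prop :=
  ∀ K : Set (X × ℝ), IsCompact K → K ⊆ D → ∃ C : ℝ, 0 < C ∧
    ∀ (x : X) (y₁ y₂ : ℝ), (x, y₁) ∈ K → (x, y₂) ∈ K → |f x y₁ - f x y₂| ≤ C * |y₁ - y₂|

/-- `f : M × D → ℝ` is radial (`G`-invariant) in its first variable. -/
def RadialInFst (G : Type*) {X : Type*} [SMul G X] (f : X → ℝ → ℝ) (D : Set ℝ) : Prop :=
  ∀ (g : G) (x : X) (y : ℝ), y ∈ D → f (g • x) y = f x y

/-! ### Unimodular groups -/

/-- A topological group is unimodular if its left Haar measures and its right Haar measures are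
the same: a Borel measure that is finite on compact sets and positive on nonempty open sets is
left-invariant if and only if it is right-invariant. -/
def IsUnimodular (G : Type*) [Group G] [TopologicalSpace G] : Prop :=
  letI : MeasurableSpace G := borel G
  ∀ μ : Measure G, IsFiniteMeasureOnCompacts μ → μ.IsOpenPosMeasure →
    (μ.IsMulLeftInvariant ↔ μ.IsMulRightInvariant)

/-! ### Group actions -/

section Orbits

variable {n : ℕ} {H : Type*} [TopologicalSpace H]
  (I : ModelWithCorners ℝ (EuclideanSpace ℝ (Fin n)) H)
  {EG : Type*} [NormedAddCommGroup EG] [NormedSpace ℝ EG]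
  {HG : Type*} [TopologicalSpace HG] (IG : ModelWithCorners ℝ EG HG)
  {F : Type*} [NormedAddCommGroup F] [NormedSpace ℝ F]
  {K : Type*} [TopologicalSpace K] (J : ModelWithCorners ℝ F K)

/-- The set `M₀` of the points of `M` that are neither fixed by the action nor on the boundary
of `M`. -/
def nonfixedInterior (G : Type*) {M : Type*} [TopologicalSpace M] [ChartedSpace H M]
    [Group G] [MulAction G M] : Set M :=
  {x : M | MulAction.orbit G x ≠ {x}} \ I.boundary M

/-- The tangent space at `x` of the orbit `G • x`: the range of the differential at `1` of the
orbit map `g ↦ g • x` (a subspace of `T_{1 • x} M = T_x M`). -/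
def orbitTangent (G : Type*) {M : Type*} [TopologicalSpace M] [ChartedSpace H M]
    [Group G] [TopologicalSpace G] [ChartedSpace HG G] [MulAction G M] (x : M) :
    Submodule ℝ (TangentSpace I x) :=
  one_smul G x ▸ LinearMap.range (mfderiv IG I (fun g : G ↦ g • x) 1).toLinearMap

/-- The Riemannian measure `A(x)` of the orbit `G • x`, a submanifold of dimension `n - 1`: its
`(n - 1)`-dimensional Hausdorff measure for the Riemannian distance of `M`, normalized so as to be
Lebesgue measure on `ℝⁿ⁻¹`. -/
def orbitVolume (n : ℕ) (G : Type*) {M : Type*} [EMetricSpace M] [Group G] [MulAction G M]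
    (x : M) : ENNReal :=
  letI : MeasurableSpace M := borel M
  haveI : BorelSpace M := ⟨rfl⟩
  (Measure.euclideanHausdorffMeasure (n - 1) : Measure M) (MulAction.orbit G x)

/-- The geometric setting. `Σ̃` is the immersed submanifold of `M` that is parameterized by the
injective immersion `ι : N → M` of a connected one-dimensional manifold `N`, possibly with
boundary, and `Σ` is the part of `Σ̃` in `M₀`. -/
structure IsPolarAction (G : Type*) {M : Type*} [EMetricSpace M] [ChartedSpace H M]
    [RiemannianBundle (fun x : M ↦ TangentSpace I x)]
    [Group G] [TopologicalSpace G] [ChartedSpace HG G] [MulAction G M]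
    {N : Type*} [TopologicalSpace N] [ChartedSpace K N] (ι : N → M) : Prop where
  /-- `G` acts by isometries of the Riemannian metric. -/
  isometric : ∀ (g : G) (x : M) (v w : TangentSpace I x),
    inner ℝ (mfderiv I I (fun z : M ↦ g • z) x v) (mfderiv I I (fun z : M ↦ g • z) x w) =
      inner ℝ v w
  injective : Function.Injective ι
  smooth : ContMDiff J I ∞ ι
  immersion : ∀ t : N, Function.Injective (mfderiv J I ι t)
  /-- `T_x M = T_x Σ̃ ⊕ T_x (G • x)` at the points `x` of `Σ̃` in `M₀`. -/
  transversal : ∀ t : N, ι t ∈ nonfixedInterior I G →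
    IsCompl (LinearMap.range (mfderiv J I ι t).toLinearMap) (orbitTangent I IG G (ι t))
  /-- `M₀` is open in `M`. -/
  isOpen_nonfixed : IsOpen (nonfixedInterior (M := M) I G)
  /-- `Σ` is open in `Σ̃`. -/
  isOpen_section : IsOpen (ι ⁻¹' nonfixedInterior I G)
  /-- `Σ` is connected. -/
  connected_section : IsConnected (ι ⁻¹' nonfixedInterior I G)
  /-- Every orbit in `M₀` meets `Σ`. -/
  meets_orbits : ∀ x ∈ nonfixedInterior (M := M) I G,
    ∃ t : N, ι t ∈ nonfixedInterior I G ∧ ∃ g : G, g • ι t = x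
  /-- The orbits of the points of `Σ` have finite Riemannian measure. -/
  orbitVolume_ne_top : ∀ t : N, ι t ∈ nonfixedInterior I G → orbitVolume n G (ι t) ≠ ⊤
  /-- The volume function `A` is smooth on `Σ`. -/
  orbitVolume_smooth : ContMDiffOn J 𝓘(ℝ, ℝ) ∞ (fun t : N ↦ (orbitVolume n G (ι t)).toReal)
    (ι ⁻¹' nonfixedInterior I G)

end Orbits

section Riemannian

variable {n : ℕ} {H : Type*} [TopologicalSpace H]
  (I : ModelWithCorners ℝ (EuclideanSpace ℝ (Fin n)) H)
  {M : Type*} [TopologicalSpace M] [ChartedSpace H M]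
  [RiemannianBundle (fun x : M ↦ TangentSpace I x)]

/-! ### Gradient and Laplace-Beltrami operator -/

/-- The Riemannian gradient: `⟪∇u(x), v⟫ = d_x u (v)` for all `v ∈ T_x M`. -/
def riemannianGradient (u : M → ℝ) (x : M) : TangentSpace I x :=
  haveI : FiniteDimensional ℝ (TangentSpace I x) :=
    inferInstanceAs (FiniteDimensional ℝ (EuclideanSpace ℝ (Fin n)))
  haveI : CompleteSpace (TangentSpace I x) := FiniteDimensional.complete ℝ _
  (InnerProductSpace.toDual ℝ (TangentSpace I x)).symm (mfderiv I 𝓘(ℝ, ℝ) u x)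

/-- The coordinate vector field `∂ᵢ` of the chart `e`, at the point with coordinates `y`. -/
def coordVector (e : OpenPartialHomeomorph M H) (i : Fin n) (y : EuclideanSpace ℝ (Fin n)) :
    TangentSpace I ((e.extend I).symm y) :=
  mfderivWithin 𝓘(ℝ, EuclideanSpace ℝ (Fin n)) I (e.extend I).symm (range I) y
    (EuclideanSpace.single i (1 : ℝ) : EuclideanSpace ℝ (Fin n))

/-- The matrix `(g_{ij})` of the Riemannian metric in the chart `e`, at the point with
coordinates `y`. -/
def metricMatrix (e : OpenPartialHomeomorph M H) (y : EuclideanSpace ℝ (Fin n)) :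
    Matrix (Fin n) (Fin n) ℝ :=
  Matrix.of fun i j ↦ inner ℝ (coordVector I e i y) (coordVector I e j y)

/-- The partial derivative `∂w/∂xᵢ` of a function defined on the range of the model (an ordinary
partial derivative at interior points). -/
def partialDeriv (i : Fin n) (w : EuclideanSpace ℝ (Fin n) → ℝ) (y : EuclideanSpace ℝ (Fin n)) :
    ℝ :=
  fderivWithin ℝ w (range I) y (EuclideanSpace.single i 1)

/-- The Laplace-Beltrami operator computed in the chart `e`:
`Δu = (1 / √ḡ) ∑ₖ ∂ₖ (∑ᵢ g^{ik} √ḡ ∂ᵢ u)` with `ḡ = det (g_{ij})` and `(g^{ij}) = (g_{ij})⁻¹`. -/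
def laplaceBeltrami (e : OpenPartialHomeomorph M H) (u : M → ℝ) (x : M) : ℝ :=
  (√(metricMatrix I e (e.extend I x)).det)⁻¹ *
    ∑ k, partialDeriv I k
      (fun y ↦ ∑ i, (metricMatrix I e y)⁻¹ i k * √(metricMatrix I e y).det *
        partialDeriv I i (u ∘ (e.extend I).symm) y)
      (e.extend I x)

/-- `u` solves `-Δ_M u + f(x, u(x)) = 0` at the points of `U`. The operator `Δ_M` does not depend
on the coordinates in which it is computed; the equation holds in all smooth charts of `M`. -/
def SolvesOn (f : M → ℝ → ℝ) (u : M → ℝ) (U : Set M) : Prop :=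
  ∀ e ∈ IsManifold.maximalAtlas I ∞ M, ∀ x ∈ e.source ∩ U,
    -laplaceBeltrami I e u x + f x (u x) = 0

/-- `u` is a maximal radial solution of class `C²`: a `G`-invariant function on `M₀`, of class
`C²` there, that solves `-Δ_M u + f(x, u(x)) = 0` on `M₀`. Values of `u` outside `M₀` play no
role. -/
structure IsMaximalRadialSolution (G : Type*) [Group G] [MulAction G M]
    (f : M → ℝ → ℝ) (u : M → ℝ) : Prop where
  contMDiffOn : ContMDiffOn I 𝓘(ℝ, ℝ) 2 u (nonfixedInterior I G)
  radial : ∀ (g : G), ∀ x ∈ nonfixedInterior (M := M) I G, u (g • x) = u x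
  solves : SolvesOn I f u (nonfixedInterior I G)

end Riemannian

end PolarPDE

end

/-!
Let `w = u₁ - u₂`. The function `w` is `G`-invariant, so its differential annihilates the
fundamental fields `X_ξ` of the action: `dw (X_ξ) = 0` on `M₀`. Differentiating this identity in
a chart gives `D²w (v, X_ξ) = -dw (DX_ξ v)`, so that second derivatives of `w` involving an orbit
direction are expressions of first order in `w`. At a point `p` of the section, the orbit
directions together with one vector `v₀` span the tangent space, and they still do so near `p`.
The principal part of `Δ_M w` is therefore `Q D²w (v₀, v₀)` up to terms bounded by `|dw|`, where
`Q > 0` because the metric is definite. Since `f` is Lipschitz between the graphs of `u₁` and `u₂`,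
the equation yields `|D²w| ≤ C (|w| + |dw|)` in a neighbourhood of `p` in `M`
(`exists_eventually_norm_hessian_le`). If `w` and `dw` vanish at `p`, Grönwall's inequality
along the segments issuing from `p` in the chart shows that `w` vanishes near `p`
(`eventually_eq_zero_of_norm_hessian_le`, `eventually_eq_of_fderiv_eq`).

Hence the set of the points of the section near which `u₁ = u₂` is open, and it is closed in the
section since `w` and `dw` are continuous. The section being connected, `u₁ = u₂` on all of it, and
on `M₀` because every orbit in `M₀` meets the section (`eqOn_nonfixedInterior`).
-/

noncomputable section

namespace PolarPDE

open Filter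

/-! ### Invariant functions satisfying an elliptic inequality -/

lemma exists_eventually_norm_le {X E : Type*} [TopologicalSpace X] [SeminormedAddCommGroup E]
    {f : X → E} {x : X} (hf : ContinuousAt f x) : ∃ C : ℝ, 0 ≤ C ∧ ∀ᶠ y in 𝓝 x, ‖f y‖ ≤ C :=
  ⟨‖f x‖ + 1, by positivity,
    (hf.norm.eventually_lt continuousAt_const (lt_add_one _)).mono fun _ h ↦ h.le⟩

/-- A continuous family of linear maps onto a finite-dimensional space, surjective at one point,
has near that point a family of right inverses that is continuous at the point. -/
lemma exists_continuousAt_rightInverse {X V E : Type*} [TopologicalSpace X]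
    [NormedAddCommGroup V] [NormedSpace ℝ V] [NormedAddCommGroup E] [NormedSpace ℝ E]
    [FiniteDimensional ℝ E] {L : X → V →L[ℝ] E} {x : X} (hL : ContinuousAt L x)
    (hsurj : Function.Surjective (L x)) :
    ∃ R : X → E →L[ℝ] V, ContinuousAt R x ∧ ∀ᶠ y in 𝓝 x, ∀ v, L y (R y v) = v := by
  have : CompleteSpace E := FiniteDimensional.complete ℝ E
  obtain ⟨r, hr⟩ := (L x).toLinearMap.exists_rightInverse_of_surjective
    (LinearMap.range_eq_top.2 hsurj)
  set R₀ : E →L[ℝ] V := LinearMap.toContinuousLinearMap r with hR₀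
  have h0 : (L x).comp R₀ = 1 := by
    ext v
    exact LinearMap.congr_fun hr v
  have hc : ContinuousAt (fun y ↦ (L y).comp R₀) x := hL.clm_comp continuousAt_const
  have hu : IsUnit ((L x).comp R₀) := h0 ▸ isUnit_one
  refine ⟨fun y ↦ R₀.comp (Ring.inverse ((L y).comp R₀)), ?_, ?_⟩
  · refine continuousAt_const.clm_comp ?_
    obtain ⟨U, hU⟩ := hu
    have := NormedRing.inverse_continuousAt U
    rw [hU] at this
    exact ContinuousAt.comp (f := fun y ↦ (L y).comp R₀) (g := Ring.inverse) this hc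
  · have : ∀ᶠ y in 𝓝 x, IsUnit ((L y).comp R₀) :=
      hc.eventually (Units.isOpen.mem_nhds hu)
    filter_upwards [this] with y hy v
    exact DFunLike.congr_fun (Ring.mul_inverse_cancel _ hy) v

/-- Differentiating `dW (X ξ) = 0`: the Hessian of `W` at `(v, X ξ)` is a first-order expression
in `W`. -/
lemma hessian_apply_of_fderiv_eq_zero {E V : Type*}
    [NormedAddCommGroup V] [NormedSpace ℝ V] [NormedAddCommGroup E] [NormedSpace ℝ E]
    {W : E → ℝ} {X : E → V →L[ℝ] E} {y : E}
    (hW : DifferentiableAt ℝ (fderiv ℝ W) y) (hX : DifferentiableAt ℝ X y)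
    (h : ∀ᶠ z in 𝓝 y, ∀ ξ, fderiv ℝ W z (X z ξ) = 0) (v : E) (ξ : V) :
    fderiv ℝ (fderiv ℝ W) y v (X y ξ) = -fderiv ℝ W y (fderiv ℝ X y v ξ) := by
  have h1 : HasFDerivAt (fun z ↦ fderiv ℝ W z (X z ξ)) _ y :=
    hW.hasFDerivAt.clm_apply (hX.hasFDerivAt.clm_apply (hasFDerivAt_const ξ y))
  have h2 : (fun z ↦ fderiv ℝ W z (X z ξ)) =ᶠ[𝓝 y] fun _ ↦ 0 := h.mono fun z hz ↦ hz ξ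
  have h3 := h1.unique ((hasFDerivAt_const (0 : ℝ) y).congr_of_eventuallyEq h2)
  have h4 := DFunLike.congr_fun h3 v
  simp at h4
  linarith

/-- If the first derivatives of `W` vanish along the fields `X ξ`, which span a complement of the
line `ℝ v₀` at `y₀`, then the second-order part of an elliptic operator applied to `W` sees only
the second derivative in the direction `v₀`, up to first-order terms. An elliptic inequality
`|L W| ≤ C |W|` therefore bounds the whole Hessian of `W`. -/
lemma exists_eventually_norm_hessian_le {κ E V : Type*} [Fintype κ]
    [NormedAddCommGroup E] [NormedSpace ℝ E] [FiniteDimensional ℝ E]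
    [NormedAddCommGroup V] [NormedSpace ℝ V] (e : Module.Basis κ ℝ E)
    {W : E → ℝ} {y₀ v₀ : E} {X : E → V →L[ℝ] E} {a : E → Matrix κ κ ℝ} {b : κ → E → ℝ} {C₀ : ℝ}
    (hW : ContDiffAt ℝ 2 W y₀) (hX : ContDiffAt ℝ 1 X y₀)
    (hWX : ∀ᶠ y in 𝓝 y₀, ∀ ξ, fderiv ℝ W y (X y ξ) = 0)
    (hspan : ∀ v, ∃ (c : ℝ) (ξ : V), v = c • v₀ + X y₀ ξ) (hv₀ : ∀ ξ, X y₀ ξ ≠ v₀)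
    (ha : ContinuousAt a y₀) (hpos : (a y₀).PosDef) (hb : ∀ i, ContinuousAt (b i) y₀)
    (hL : ∀ᶠ y in 𝓝 y₀,
      |∑ i, ∑ j, a y i j * fderiv ℝ (fderiv ℝ W) y (e i) (e j) +
        ∑ i, b i y * fderiv ℝ W y (e i)| ≤ C₀ * |W y|) :
    ∃ C : ℝ,
      ∀ᶠ y in 𝓝 y₀, ‖fderiv ℝ (fderiv ℝ W) y‖ ≤ C * (|W y| + ‖fderiv ℝ W y‖) := by
  obtain ⟨R, hR, hLR⟩ := exists_continuousAt_rightInverse (x := y₀)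
    (L := fun y ↦ ((ContinuousLinearMap.fst ℝ ℝ V).smulRight v₀ : ℝ × V →L[ℝ] E) +
      (X y).comp (ContinuousLinearMap.snd ℝ ℝ V))
    (continuousAt_const.add (hX.continuousAt.clm_comp continuousAt_const))
    (fun v ↦ by obtain ⟨c, ξ, h⟩ := hspan v; exact ⟨(c, ξ), by simp [h]⟩)
  have hRv : ∀ᶠ y in 𝓝 y₀, ∀ v, v = (R y v).1 • v₀ + X y (R y v).2 :=
    hLR.mono fun y hy v ↦ by simpa using (hy v).symm
  set Q : E → ℝ := fun y ↦ ∑ i, ∑ j, a y i j * ((R y (e i)).1 * (R y (e j)).1) with hQ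
  have hs : ∀ i, ContinuousAt (fun y ↦ (R y (e i)).1) y₀ := fun i ↦
    continuous_fst.continuousAt.comp (hR.clm_apply continuousAt_const)
  have haij : ∀ i j, ContinuousAt (fun y ↦ a y i j) y₀ := fun i j ↦
    ((continuous_apply_apply i j).continuousAt).comp ha
  have hQc : ContinuousAt Q y₀ :=
    tendsto_finsetSum _ fun i _ ↦ tendsto_finsetSum _ fun j _ ↦
      (haij i j).mul ((hs i).mul (hs j))
  -- The `v₀`-components of the basis vectors do not all vanish at `y₀`, since `v₀` is not a value
  -- of `X y₀`; so the coefficient `Q` of the pure `v₀`-derivative is positive.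
  have hQ0 : 0 < Q y₀ := by
    have hne0 : (fun i ↦ (R y₀ (e i)).1) ≠ 0 := by
      intro h0
      have h1 : (ContinuousLinearMap.fst ℝ ℝ V).toLinearMap ∘ₗ (R y₀).toLinearMap = 0 :=
        e.ext fun i ↦ congrFun h0 i
      have h2 := hRv.self_of_nhds v₀
      rw [show (R y₀ v₀).1 = 0 from LinearMap.congr_fun h1 v₀, zero_smul, zero_add] at h2
      exact hv₀ _ h2.symm
    have := hpos.dotProduct_mulVec_pos hne0
    simp only [dotProduct, Matrix.mulVec, Finset.mul_sum, star_trivial] at this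
    refine this.trans_eq ?_
    exact Finset.sum_congr rfl fun i _ ↦ Finset.sum_congr rfl fun j _ ↦ by ring
  obtain ⟨r, hr0, hr⟩ := exists_eventually_norm_le hR
  obtain ⟨D, hD0, hD⟩ := exists_eventually_norm_le
    (hX.fderiv_right (m := 0) (by norm_num)).continuousAt
  obtain ⟨A, hA0, hA⟩ := exists_eventually_norm_le (x := y₀)
    (f := fun y ↦ ∑ i, ∑ j, ‖a y i j‖ * (‖e i‖ * ‖e j‖))
    (tendsto_finsetSum _ fun i _ ↦ tendsto_finsetSum _ fun j _ ↦
      (haij i j).norm.mul continuousAt_const)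
  obtain ⟨B, hB0, hB⟩ := exists_eventually_norm_le (x := y₀) (f := fun y ↦ ∑ i, ‖b i y‖ * ‖e i‖)
    (tendsto_finsetSum _ fun i _ ↦ (hb i).norm.mul continuousAt_const)
  have hQev : ∀ᶠ y in 𝓝 y₀, Q y₀ / 2 ≤ Q y :=
    (hQc.eventually_const_lt (half_lt_self hQ0)).mono fun _ h ↦ h.le
  have hsymm : ∀ᶠ y in 𝓝 y₀, ∀ v w,
      fderiv ℝ (fderiv ℝ W) y v w = fderiv ℝ (fderiv ℝ W) y w v :=
    (hW.eventually (by simp)).mono fun y hy v w ↦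
      (hy.isSymmSndFDerivAt (by simp)) v w
  have hW2 : ∀ᶠ y in 𝓝 y₀, DifferentiableAt ℝ (fderiv ℝ W) y :=
    ((hW.fderiv_right (m := 1) (by norm_num)).eventually (by simp)).mono fun y hy ↦
      hy.differentiableAt (by norm_num)
  have hX1 : ∀ᶠ y in 𝓝 y₀, DifferentiableAt ℝ X y :=
    (hX.eventually (by simp)).mono fun y hy ↦ hy.differentiableAt (by norm_num)
  set T : ℝ := r * D * ‖v₀‖ * r + D * r with hT
  have hT0 : 0 ≤ T := by positivity
  set C₁ : ℝ := |C₀| + A * T + B with hC₁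
  have hC₁0 : 0 ≤ C₁ := by positivity
  refine ⟨r ^ 2 * (C₁ / (Q y₀ / 2)) + T, ?_⟩
  filter_upwards [hRv, hr, hD, hA, hB, hQev, hsymm, hW2, hX1, hL, hWX.eventually_nhds]
    with y hRv hr hD hA hB hQy hsymm hW2 hX1 hL hWX
  set Hs := fderiv ℝ (fderiv ℝ W) y with hHs
  set β := Hs v₀ v₀ with hβ
  have hR1 : ∀ v, |(R y v).1| ≤ r * ‖v‖ := fun v ↦
    ((norm_fst_le (R y v)).trans ((R y).le_opNorm v)).trans (by gcongr)
  have hR2 : ∀ v, ‖(R y v).2‖ ≤ r * ‖v‖ := fun v ↦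
    ((norm_snd_le (R y v)).trans ((R y).le_opNorm v)).trans (by gcongr)
  have hDv : ∀ v ξ, |fderiv ℝ W y (fderiv ℝ X y v ξ)| ≤ ‖fderiv ℝ W y‖ * (D * ‖v‖ * ‖ξ‖) :=
    fun v ξ ↦ ((fderiv ℝ W y).le_opNorm _).trans <| by
      gcongr
      exact ((fderiv ℝ X y).le_opNorm₂ v ξ).trans (by gcongr)
  have hθ : ∀ v w, |Hs v w - (R y v).1 * (R y w).1 * β| ≤ T * ‖fderiv ℝ W y‖ * (‖v‖ * ‖w‖) := by
    intro v w
    have hX' := hessian_apply_of_fderiv_eq_zero hW2 hX1 hWX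
    have h1 : Hs v w = (R y w).1 * Hs v v₀ - fderiv ℝ W y (fderiv ℝ X y v (R y w).2) := by
      conv_lhs => rw [hRv w]
      rw [map_add, map_smul, hX', smul_eq_mul, sub_eq_add_neg]
    have h2 : Hs v v₀ = (R y v).1 * β - fderiv ℝ W y (fderiv ℝ X y v₀ (R y v).2) := by
      rw [hsymm]
      conv_lhs => rw [hRv v]
      rw [map_add, map_smul, hX', smul_eq_mul, sub_eq_add_neg]
    have h3 : Hs v w - (R y v).1 * (R y w).1 * β =
        -((R y w).1 * fderiv ℝ W y (fderiv ℝ X y v₀ (R y v).2)) -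
          fderiv ℝ W y (fderiv ℝ X y v (R y w).2) := by
      rw [h1, h2]; ring
    rw [h3]
    refine (abs_sub _ _).trans ?_
    rw [abs_neg, abs_mul]
    calc _ ≤ (r * ‖w‖) * (‖fderiv ℝ W y‖ * (D * ‖v₀‖ * (r * ‖v‖))) +
          ‖fderiv ℝ W y‖ * (D * ‖v‖ * (r * ‖w‖)) := by
          gcongr
          · exact hR1 w
          · exact (hDv _ _).trans (by gcongr; exact hR2 v)
          · exact (hDv _ _).trans (by gcongr; exact hR2 w)
      _ = _ := by rw [hT]; ring
  have hβle : |β| ≤ C₁ / (Q y₀ / 2) * (|W y| + ‖fderiv ℝ W y‖) := by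
    have h1 : Q y * β = (∑ i, ∑ j, a y i j * Hs (e i) (e j) + ∑ i, b i y * fderiv ℝ W y (e i)) -
        ∑ i, ∑ j, a y i j * (Hs (e i) (e j) - (R y (e i)).1 * (R y (e j)).1 * β) -
        ∑ i, b i y * fderiv ℝ W y (e i) := by
      simp only [hQ, mul_sub, Finset.sum_sub_distrib, Finset.sum_mul]
      have : ∀ i j, a y i j * ((R y (e i)).1 * (R y (e j)).1) * β =
        a y i j * ((R y (e i)).1 * (R y (e j)).1 * β) := fun i j ↦ by ring
      simp only [this]
      ring
    have h2 : |∑ i, ∑ j, a y i j * (Hs (e i) (e j) - (R y (e i)).1 * (R y (e j)).1 * β)| ≤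
        A * (T * ‖fderiv ℝ W y‖) := by
      refine le_trans ?_ (mul_le_mul_of_nonneg_right ((le_abs_self _).trans hA) (by positivity))
      rw [Finset.sum_mul]
      refine (Finset.abs_sum_le_sum_abs _ _).trans (Finset.sum_le_sum fun i _ ↦ ?_)
      rw [Finset.sum_mul]
      refine (Finset.abs_sum_le_sum_abs _ _).trans (Finset.sum_le_sum fun j _ ↦ ?_)
      rw [abs_mul, Real.norm_eq_abs]
      calc _ ≤ |a y i j| * (T * ‖fderiv ℝ W y‖ * (‖e i‖ * ‖e j‖)) := by gcongr; exact hθ _ _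
        _ = _ := by ring
    have h3 : |∑ i, b i y * fderiv ℝ W y (e i)| ≤ B * ‖fderiv ℝ W y‖ := by
      refine le_trans ?_ (mul_le_mul_of_nonneg_right ((le_abs_self _).trans hB) (by positivity))
      rw [Finset.sum_mul]
      refine (Finset.abs_sum_le_sum_abs _ _).trans (Finset.sum_le_sum fun i _ ↦ ?_)
      rw [abs_mul, Real.norm_eq_abs, mul_assoc, mul_comm ‖e i‖]
      gcongr
      exact (fderiv ℝ W y).le_opNorm _
    have h4 : Q y₀ / 2 * |β| ≤ C₁ * (|W y| + ‖fderiv ℝ W y‖) := by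
      calc Q y₀ / 2 * |β| ≤ Q y * |β| := by gcongr
        _ = |Q y * β| := by rw [abs_mul, abs_of_pos ((half_pos hQ0).trans_le hQy)]
        _ ≤ C₀ * |W y| + A * (T * ‖fderiv ℝ W y‖) + B * ‖fderiv ℝ W y‖ := by
          rw [h1]
          exact (abs_sub _ _).trans (add_le_add ((abs_sub _ _).trans (add_le_add hL h2)) h3)
        _ ≤ _ := by
          have hw := abs_nonneg (W y)
          have hdw := norm_nonneg (fderiv ℝ W y)
          have := mul_le_mul_of_nonneg_right (le_abs_self C₀) hw
          have h5 : 0 ≤ (A * T + B) * |W y| := by positivity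
          have h6 : 0 ≤ |C₀| * ‖fderiv ℝ W y‖ := by positivity
          rw [hC₁]
          linarith
    rw [div_mul_eq_mul_div, le_div_iff₀ (half_pos hQ0)]
    linarith
  refine ContinuousLinearMap.opNorm_le_bound₂ _ (by positivity) fun v w ↦ ?_
  have h1 : Hs v w = (R y v).1 * (R y w).1 * β + (Hs v w - (R y v).1 * (R y w).1 * β) := by ring
  rw [h1]
  refine (norm_add_le _ _).trans ?_
  calc _ ≤ (r * ‖v‖) * (r * ‖w‖) * (C₁ / (Q y₀ / 2) * (|W y| + ‖fderiv ℝ W y‖)) +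
        T * ‖fderiv ℝ W y‖ * (‖v‖ * ‖w‖) := by
        rw [norm_mul, norm_mul]
        gcongr
        · exact hR1 v
        · exact hR1 w
        · exact hβle
        · exact hθ v w
    _ ≤ _ := by
      have : 0 ≤ T * |W y| * (‖v‖ * ‖w‖) := by positivity
      linarith

/-- Grönwall: a function whose Hessian is bounded by its value and its gradient vanishes near
every point where the value and the gradient vanish. -/
lemma eventually_eq_zero_of_norm_hessian_le {E : Type*} [NormedAddCommGroup E] [NormedSpace ℝ E]
    {W : E → ℝ} {y₀ : E} {C : ℝ} (hW : ContDiffAt ℝ 2 W y₀) (h0 : W y₀ = 0)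
    (h1 : fderiv ℝ W y₀ = 0)
    (hC : ∀ᶠ y in 𝓝 y₀, ‖fderiv ℝ (fderiv ℝ W) y‖ ≤ C * (|W y| + ‖fderiv ℝ W y‖)) :
    ∀ᶠ y in 𝓝 y₀, W y = 0 := by
  have hd : ∀ᶠ y in 𝓝 y₀, ContDiffAt ℝ 2 W y := hW.eventually (by simp)
  obtain ⟨ε, hε, hball⟩ := Metric.eventually_nhds_iff_ball.1 (hC.and hd)
  refine Metric.eventually_nhds_iff_ball.2 ⟨ε, hε, fun y hy ↦ ?_⟩
  set c : ℝ → E := fun τ ↦ y₀ + τ • (y - y₀) with hcdef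
  have hc : ∀ τ, HasDerivAt c (y - y₀) τ := fun τ ↦ by
    simpa [hcdef] using ((hasDerivAt_id τ).smul_const (y - y₀)).const_add y₀
  have hmem : ∀ τ ∈ Icc (0 : ℝ) 1, c τ ∈ Metric.ball y₀ ε := fun τ hτ ↦
    (convex_ball y₀ ε).add_smul_sub_mem (Metric.mem_ball_self hε) hy hτ
  set Ψ : ℝ → ℝ × (E →L[ℝ] ℝ) := fun τ ↦ (W (c τ), fderiv ℝ W (c τ)) with hΨ
  have hder : ∀ τ ∈ Icc (0 : ℝ) 1, HasDerivAt Ψ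
      (fderiv ℝ W (c τ) (y - y₀), fderiv ℝ (fderiv ℝ W) (c τ) (y - y₀)) τ := by
    intro τ hτ
    have hd := (hball _ (hmem τ hτ)).2
    refine HasDerivAt.prodMk ?_ ?_
    · exact (hd.differentiableAt (by norm_num)).hasFDerivAt.comp_hasDerivAt τ (hc τ)
    · exact ((hd.fderiv_right (m := 1) (by norm_num)).differentiableAt
        (by norm_num)).hasFDerivAt.comp_hasDerivAt τ (hc τ)
  have hgr := norm_le_gronwallBound_of_norm_deriv_right_le (f := Ψ) (a := 0) (b := 1) (δ := 0)
    (K := (1 + 2 * |C|) * ‖y - y₀‖) (ε := 0)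
    (fun τ hτ ↦ (hder τ hτ).continuousAt.continuousWithinAt)
    (fun τ hτ ↦ (hder τ ⟨hτ.1, hτ.2.le⟩).hasDerivWithinAt)
    (by simp [hΨ, hcdef, h0, h1])
    (fun τ hτ ↦ by
      have hb := (hball _ (hmem τ ⟨hτ.1, hτ.2.le⟩)).1
      have hΨ1 : |W (c τ)| ≤ ‖Ψ τ‖ := norm_fst_le (Ψ τ)
      have hΨ2 : ‖fderiv ℝ W (c τ)‖ ≤ ‖Ψ τ‖ := norm_snd_le (Ψ τ)
      have hb' : ‖fderiv ℝ (fderiv ℝ W) (c τ)‖ ≤ 2 * |C| * ‖Ψ τ‖ := by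
        refine hb.trans ?_
        calc _ ≤ |C| * (‖Ψ τ‖ + ‖Ψ τ‖) := by gcongr; exact le_abs_self C
          _ = _ := by ring
      rw [add_zero, Prod.norm_def]
      refine max_le ?_ ?_
      · refine (ContinuousLinearMap.le_opNorm _ _).trans ?_
        calc _ ≤ ‖Ψ τ‖ * ‖y - y₀‖ := by gcongr
          _ ≤ _ := by
            have : 0 ≤ |C| * ‖y - y₀‖ * ‖Ψ τ‖ := by positivity
            linarith
      · refine (ContinuousLinearMap.le_opNorm _ _).trans ?_
        calc _ ≤ 2 * |C| * ‖Ψ τ‖ * ‖y - y₀‖ := by gcongr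
          _ ≤ _ := by
            have : 0 ≤ ‖y - y₀‖ * ‖Ψ τ‖ := by positivity
            linarith)
    1 (by simp)
  rw [gronwallBound_ε0_δ0] at hgr
  have : (Ψ 1).1 = 0 := by rw [norm_le_zero_iff.1 hgr]; rfl
  simpa [hΨ, hcdef] using this

/-! ### The Laplace-Beltrami operator in a chart -/

section MatrixSmoothness

variable {E κ : Type*} [NormedAddCommGroup E] [NormedSpace ℝ E] [Fintype κ] [DecidableEq κ]
  {m : WithTop ℕ∞} {A : E → Matrix κ κ ℝ} {y : E}

lemma contDiffAt_det (h : ∀ i j, ContDiffAt ℝ m (fun z ↦ A z i j) y) :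
    ContDiffAt ℝ m (fun z ↦ (A z).det) y := by
  simp only [Matrix.det_apply']
  exact ContDiffAt.sum fun σ _ ↦ contDiffAt_const.mul (contDiffAt_prod fun i _ ↦ h _ _)

lemma contDiffAt_inv_apply (h : ∀ i j, ContDiffAt ℝ m (fun z ↦ A z i j) y)
    (h0 : (A y).det ≠ 0) (i j : κ) : ContDiffAt ℝ m (fun z ↦ (A z)⁻¹ i j) y := by
  simp only [Matrix.inv_def, Ring.inverse_eq_inv', Matrix.smul_apply, smul_eq_mul,
    Matrix.adjugate_apply]
  refine ((contDiffAt_det h).inv h0).mul (contDiffAt_det fun k l ↦ ?_)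
  simp only [Matrix.updateRow_apply]
  split_ifs
  · exact contDiffAt_const
  · exact h k l

end MatrixSmoothness

lemma linearIndependent_map_single {n : ℕ} {T : Type*} [AddCommGroup T] [Module ℝ T]
    (D : EuclideanSpace ℝ (Fin n) →ₗ[ℝ] T) (hD : Function.Injective D) :
    LinearIndependent ℝ fun i ↦ D (EuclideanSpace.single i 1) := by
  have h := (EuclideanSpace.basisFun (Fin n) ℝ).toBasis.linearIndependent.map' D
    (LinearMap.ker_eq_bot.2 hD)
  simpa [Function.comp_def] using h

section Chart

variable {n : ℕ} {H : Type*} [TopologicalSpace H]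
  (I : ModelWithCorners ℝ (EuclideanSpace ℝ (Fin n)) H)
  {M : Type*} [TopologicalSpace M] [ChartedSpace H M]

lemma extChartAt_target_mem_nhds_of_isInteriorPoint {p : M} (hp : I.IsInteriorPoint p) :
    (extChartAt I p).target ∈ 𝓝 (extChartAt I p p) := by
  have h := extChartAt_target_mem_nhdsWithin (I := I) p
  rwa [nhdsWithin_eq_nhds.2 (range_mem_nhds_isInteriorPoint hp)] at h

lemma mfderivWithin_extChartAt_symm_eq {p : M} {y : EuclideanSpace ℝ (Fin n)}
    {s : Set (EuclideanSpace ℝ (Fin n))} (hs : s ∈ 𝓝 y) (hst : s ⊆ (extChartAt I p).target) :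
    mfderivWithin 𝓘(ℝ, EuclideanSpace ℝ (Fin n)) I (extChartAt I p).symm s y =
      mfderivWithin 𝓘(ℝ, EuclideanSpace ℝ (Fin n)) I (extChartAt I p).symm (range I) y := by
  rw [mfderivWithin_of_mem_nhds hs, mfderivWithin_of_mem_nhds
    (mem_of_superset hs (hst.trans (extChartAt_target_subset_range p)))]

variable [IsManifold I ∞ M]

/-- The coordinate fields of a chart are smooth sections of the tangent bundle. -/
lemma contMDiffAt_coordVector {p : M} {y : EuclideanSpace ℝ (Fin n)}
    (hy : (extChartAt I p).target ∈ 𝓝 y) (i : Fin n) :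
    ContMDiffAt 𝓘(ℝ, EuclideanSpace ℝ (Fin n)) I.tangent ∞
      (fun z ↦ (⟨(extChartAt I p).symm z, coordVector I (chartAt H p) i z⟩ : TangentBundle I M))
      y := by
  have : IsManifold I 1 M := IsManifold.of_le (n := ∞) (by norm_num)
  set s := interior (extChartAt I p).target with hs
  have hst : s ⊆ (extChartAt I p).target := interior_subset
  have h1 : ContMDiffOn 𝓘(ℝ, EuclideanSpace ℝ (Fin n)) I ∞ (extChartAt I p).symm s :=
    (contMDiffOn_extChartAt_symm p).mono hst
  have h2 := h1.contMDiffOn_tangentMapWithin (m := ∞) (by simp) isOpen_interior.uniqueMDiffOn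
  have h3 : ContMDiffAt 𝓘(ℝ, EuclideanSpace ℝ (Fin n)) 𝓘(ℝ, EuclideanSpace ℝ (Fin n)).tangent ∞
      (fun z ↦ (⟨z, EuclideanSpace.single i (1 : ℝ)⟩ :
        TangentBundle 𝓘(ℝ, EuclideanSpace ℝ (Fin n)) (EuclideanSpace ℝ (Fin n)))) y :=
    contMDiffAt_vectorSpace_iff_contDiffAt.2 contDiffAt_const
  have hys : y ∈ s := mem_interior_iff_mem_nhds.2 hy
  have h4 := ContMDiffAt.comp y ((h2 _ hys).contMDiffAt
    ((isOpen_interior.preimage (FiberBundle.continuous_proj _ _)).mem_nhds hys)) h3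
  refine h4.congr_of_eventuallyEq ?_
  filter_upwards [isOpen_interior.mem_nhds hys] with z hz
  simp only [Function.comp_apply, tangentMapWithin, coordVector]
  rw [mfderivWithin_extChartAt_symm_eq I (isOpen_interior.mem_nhds hz) hst]
  rfl

variable [RiemannianBundle (fun x : M ↦ TangentSpace I x)]

lemma contDiffAt_metricMatrix
    [IsContMDiffRiemannianBundle I ∞ (EuclideanSpace ℝ (Fin n)) (fun x : M ↦ TangentSpace I x)]
    {p : M} {y : EuclideanSpace ℝ (Fin n)}
    (hy : (extChartAt I p).target ∈ 𝓝 y) (i j : Fin n) :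
    ContDiffAt ℝ ∞ (fun z ↦ metricMatrix I (chartAt H p) z i j) y :=
  contMDiffAt_iff_contDiffAt.1 <|
    (contMDiffAt_coordVector I hy i).inner_bundle (contMDiffAt_coordVector I hy j)

lemma posDef_metricMatrix {p : M} {y : EuclideanSpace ℝ (Fin n)}
    (hy : y ∈ (extChartAt I p).target) : (metricMatrix I (chartAt H p) y).PosDef := by
  have : IsManifold I 1 M := IsManifold.of_le (n := ∞) (by norm_num)
  refine Matrix.posDef_gram_of_linearIndependent (𝕜 := ℝ)
    (v := fun i ↦ coordVector I (chartAt H p) i y) ?_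
  have hinj := (isInvertible_mfderivWithin_extChartAt_symm (I := I) hy).injective
  exact linearIndependent_map_single (mfderivWithin 𝓘(ℝ, EuclideanSpace ℝ (Fin n)) I
    (extChartAt I p).symm (range I) y).toLinearMap hinj

/-- The coefficient `g^{ik} √ḡ` of the Laplace-Beltrami operator in the chart at `p`. -/
def divergenceCoeff (p : M) (i k : Fin n) (y : EuclideanSpace ℝ (Fin n)) : ℝ :=
  (metricMatrix I (chartAt H p) y)⁻¹ i k * √(metricMatrix I (chartAt H p) y).det

lemma contDiffAt_divergenceCoeff
    [IsContMDiffRiemannianBundle I ∞ (EuclideanSpace ℝ (Fin n)) (fun x : M ↦ TangentSpace I x)]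
    {p : M} {y : EuclideanSpace ℝ (Fin n)} (hy : (extChartAt I p).target ∈ 𝓝 y) (i k : Fin n) :
    ContDiffAt ℝ ∞ (divergenceCoeff I p i k) y := by
  have h := contDiffAt_metricMatrix I hy
  have h0 := (posDef_metricMatrix I (mem_of_mem_nhds hy)).det_pos.ne'
  exact (contDiffAt_inv_apply h h0 i k).mul ((contDiffAt_det h).sqrt h0)

/-- The Laplace-Beltrami operator in non-divergence form. -/
lemma eventually_laplaceBeltrami_eq
    [IsContMDiffRiemannianBundle I ∞ (EuclideanSpace ℝ (Fin n)) (fun x : M ↦ TangentSpace I x)]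
    {p : M} {y₀ : EuclideanSpace ℝ (Fin n)} (hy : (extChartAt I p).target ∈ 𝓝 y₀) {u : M → ℝ}
    (hu : ContDiffAt ℝ 2 (u ∘ (extChartAt I p).symm) y₀) :
    ∀ᶠ y in 𝓝 y₀, laplaceBeltrami I (chartAt H p) u ((extChartAt I p).symm y) =
      (√(metricMatrix I (chartAt H p) y).det)⁻¹ *
        (∑ k, ∑ i, divergenceCoeff I p i k y *
            fderiv ℝ (fderiv ℝ (u ∘ (extChartAt I p).symm)) y
              (EuclideanSpace.single k 1) (EuclideanSpace.single i 1) +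
          ∑ i, (∑ k, fderiv ℝ (divergenceCoeff I p i k) y (EuclideanSpace.single k 1)) *
            fderiv ℝ (u ∘ (extChartAt I p).symm) y (EuclideanSpace.single i 1)) := by
  set U := u ∘ (extChartAt I p).symm with hU
  have hr : ∀ᶠ y in 𝓝 y₀, range I ∈ 𝓝 y := (eventually_mem_nhds_iff.2 hy).mono fun y hy ↦
    mem_of_superset hy (extChartAt_target_subset_range p)
  have hpd : ∀ᶠ y in 𝓝 y₀, ∀ (i : Fin n) (w : EuclideanSpace ℝ (Fin n) → ℝ),
      partialDeriv I i w y = fderiv ℝ w y (EuclideanSpace.single i 1) :=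
    hr.mono fun y hy i w ↦ by rw [partialDeriv, fderivWithin_of_mem_nhds hy]
  filter_upwards [hpd.eventually_nhds, eventually_mem_nhds_iff.2 hy, hu.eventually (by simp)]
    with y hpdy hty huy
  have hleft : (chartAt H p).extend I ((extChartAt I p).symm y) = y :=
    (extChartAt I p).right_inv (mem_of_mem_nhds hty)
  rw [laplaceBeltrami, hleft]
  congr 1
  have hdU : DifferentiableAt ℝ (fderiv ℝ U) y :=
    (huy.fderiv_right (m := 1) (by norm_num)).differentiableAt (by norm_num)
  have hterm : ∀ k : Fin n, partialDeriv I k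
      (fun z ↦ ∑ i, (metricMatrix I (chartAt H p) z)⁻¹ i k *
        √(metricMatrix I (chartAt H p) z).det *
        partialDeriv I i (u ∘ ((chartAt H p).extend I).symm) z) y =
      ∑ i, (divergenceCoeff I p i k y * fderiv ℝ (fderiv ℝ U) y
          (EuclideanSpace.single k 1) (EuclideanSpace.single i 1) +
        fderiv ℝ (divergenceCoeff I p i k) y (EuclideanSpace.single k 1) *
          fderiv ℝ U y (EuclideanSpace.single i 1)) := by
    intro k
    rw [hpdy.self_of_nhds]
    have heq : (fun z ↦ ∑ i, (metricMatrix I (chartAt H p) z)⁻¹ i k *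
        √(metricMatrix I (chartAt H p) z).det *
        partialDeriv I i (u ∘ ((chartAt H p).extend I).symm) z) =ᶠ[𝓝 y]
        fun z ↦ ∑ i, divergenceCoeff I p i k z * fderiv ℝ U z (EuclideanSpace.single i 1) := by
      filter_upwards [hpdy] with z hz
      exact Finset.sum_congr rfl fun i _ ↦ by rw [hz]; rfl
    rw [heq.fderiv_eq]
    have hd : ∀ i, HasFDerivAt
        (fun z ↦ divergenceCoeff I p i k z * fderiv ℝ U z (EuclideanSpace.single i 1)) _ y :=
      fun i ↦ ((contDiffAt_divergenceCoeff I hty i k).differentiableAt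
        (by norm_num)).hasFDerivAt.mul
        (hdU.hasFDerivAt.clm_apply (hasFDerivAt_const (EuclideanSpace.single i (1 : ℝ)) y))
    rw [(HasFDerivAt.fun_sum fun i (_ : i ∈ Finset.univ) ↦ hd i).fderiv]
    simp
    exact Finset.sum_congr rfl fun i _ ↦ by ring
  simp only [hterm, Finset.sum_add_distrib]
  congr 1
  rw [Finset.sum_comm]
  simp only [Finset.sum_mul]

end Chart

/-! ### Fundamental fields of the action -/

section Action

variable {n : ℕ} {H : Type*} [TopologicalSpace H]
  (I : ModelWithCorners ℝ (EuclideanSpace ℝ (Fin n)) H)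
  {M : Type*} [TopologicalSpace M] [ChartedSpace H M]
  {EG : Type*} [NormedAddCommGroup EG] [NormedSpace ℝ EG]
  {HG : Type*} [TopologicalSpace HG] (IG : ModelWithCorners ℝ EG HG)
  (G : Type*) [Group G] [TopologicalSpace G] [ChartedSpace HG G]
  [MulAction G M]

/-- The action in coordinates: `(γ, y) ↦ φ (κ⁻¹ γ • φ⁻¹ y)`, where `φ` is the chart of `M` at `p`
and `κ` the chart of `G` at `1`. -/
def actionInChart (p : M) (z : EG × EuclideanSpace ℝ (Fin n)) : EuclideanSpace ℝ (Fin n) :=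
  extChartAt I p ((extChartAt IG (1 : G)).symm z.1 • (extChartAt I p).symm z.2)

/-- The fundamental vector fields of the action in coordinates: the derivative of
`actionInChart` in the direction of the group, at the identity. -/
def fundamentalField (p : M) (y : EuclideanSpace ℝ (Fin n)) :
    EG →L[ℝ] EuclideanSpace ℝ (Fin n) :=
  (fderiv ℝ (actionInChart I IG G p) (extChartAt IG (1 : G) 1, y)).comp
    (ContinuousLinearMap.inl ℝ EG (EuclideanSpace ℝ (Fin n)))

/-- All tangent spaces of `M` are by definition the model space, so that transporting a submodule
along an equality of base points does not change it. -/
lemma eqRec_tangentSubmodule {x y : M} (h : x = y) (S : Submodule ℝ (TangentSpace I x)) :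
    (h ▸ S : Submodule ℝ (TangentSpace I y)) = (S : Submodule ℝ (EuclideanSpace ℝ (Fin n))) := by
  subst h
  rfl

lemma actionInChart_one {p : M} {y : EuclideanSpace ℝ (Fin n)} (hy : y ∈ (extChartAt I p).target) :
    actionInChart I IG G p (extChartAt IG (1 : G) 1, y) = y := by
  simp only [actionInChart, extChartAt_to_inv, one_smul]
  exact (extChartAt I p).right_inv hy

variable [IsManifold I ∞ M] [IG.Boundaryless] [IsManifold IG ∞ G] [ContMDiffSMul IG I ∞ G M]

lemma contDiffAt_actionInChart {p : M} {y : EuclideanSpace ℝ (Fin n)}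
    (hy : (extChartAt I p).target ∈ 𝓝 y) :
    ContDiffAt ℝ ∞ (actionInChart I IG G p) (extChartAt IG (1 : G) 1, y) := by
  have h1 : ContMDiffAt 𝓘(ℝ, EG × EuclideanSpace ℝ (Fin n)) IG ∞
      (fun z : EG × EuclideanSpace ℝ (Fin n) ↦ (extChartAt IG (1 : G)).symm z.1)
      (extChartAt IG (1 : G) 1, y) :=
    ((contMDiffOn_extChartAt_symm (I := IG) (1 : G)).contMDiffAt
      (extChartAt_target_mem_nhds (I := IG) (1 : G))).comp
        (extChartAt IG (1 : G) 1, y) contDiff_fst.contMDiff.contMDiffAt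
  have h2 : ContMDiffAt 𝓘(ℝ, EG × EuclideanSpace ℝ (Fin n)) I ∞
      (fun z : EG × EuclideanSpace ℝ (Fin n) ↦ (extChartAt I p).symm z.2)
      (extChartAt IG (1 : G) 1, y) :=
    ((contMDiffOn_extChartAt_symm (I := I) p).contMDiffAt hy).comp
        (extChartAt IG (1 : G) 1, y) contDiff_snd.contMDiff.contMDiffAt
  have h3 := (ContMDiffSMul.contMDiff_smul (I := IG) (I' := I) (n := ∞) (G := G)
    (M := M)).contMDiffAt.comp (extChartAt IG (1 : G) 1, y) (h1.prodMk h2)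
  have h4 : (1 : G) • (extChartAt I p).symm y ∈ (chartAt H p).source := by
    rw [one_smul, ← extChartAt_source I]
    exact (extChartAt I p).map_target (mem_of_mem_nhds hy)
  have h5 := (contMDiffAt_extChartAt' (I := I) (n := ∞) h4).comp_of_eq h3
    (by simp)
  exact contMDiffAt_iff_contDiffAt.1 h5

lemma contDiffAt_fundamentalField {p : M} {y : EuclideanSpace ℝ (Fin n)}
    (hy : (extChartAt I p).target ∈ 𝓝 y) : ContDiffAt ℝ 1 (fundamentalField I IG G p) y := by
  have h := (contDiffAt_actionInChart I IG G hy).fderiv_right (m := 1)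
    (by norm_num; exact ENat.LEInfty.out)
  exact (h.comp y (contDiffAt_const.prodMk contDiffAt_id)).clm_comp contDiffAt_const

/-- An invariant function is annihilated by the fundamental fields of the action. -/
lemma eventually_fderiv_fundamentalField_eq_zero {p : M} {y₀ : EuclideanSpace ℝ (Fin n)}
    (hy : (extChartAt I p).target ∈ 𝓝 y₀) {u : M → ℝ} {S : Set M}
    (hS : (extChartAt I p).symm ⁻¹' S ∈ 𝓝 y₀) (hu : ∀ (g : G), ∀ x ∈ S, u (g • x) = u x)
    (hd : ContDiffAt ℝ 1 (u ∘ (extChartAt I p).symm) y₀) :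
    ∀ᶠ y in 𝓝 y₀, ∀ ξ,
      fderiv ℝ (u ∘ (extChartAt I p).symm) y (fundamentalField I IG G p y ξ) = 0 := by
  filter_upwards [eventually_mem_nhds_iff.2 hy, eventually_mem_nhds_iff.2 hS,
    hd.eventually (by simp)] with y hty hSy hdy ξ
  set γ₀ := extChartAt IG (1 : G) 1
  set U := u ∘ (extChartAt I p).symm with hU
  have ha := contDiffAt_actionInChart I IG G hty
  have ha1 := actionInChart_one I IG G (mem_of_mem_nhds hty)
  have hUd : HasFDerivAt U (fderiv ℝ U y) (actionInChart I IG G p (γ₀, y)) := by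
    rw [ha1]
    exact (hdy.differentiableAt (by norm_num)).hasFDerivAt
  have h1 := hUd.comp (γ₀, y) (ha.differentiableAt (by norm_num)).hasFDerivAt
  have h2 : HasFDerivAt (fun z : EG × EuclideanSpace ℝ (Fin n) ↦ U z.2)
      ((fderiv ℝ U y).comp (ContinuousLinearMap.snd ℝ EG (EuclideanSpace ℝ (Fin n)))) (γ₀, y) :=
    HasFDerivAt.comp (f := fun z : EG × EuclideanSpace ℝ (Fin n) ↦ z.2) (γ₀, y)
      (hdy.differentiableAt (by norm_num)).hasFDerivAt hasFDerivAt_snd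
  -- near the identity of `G`, the translate of a point of the chart stays in the chart
  have hsrc : ∀ᶠ z : EG × EuclideanSpace ℝ (Fin n) in 𝓝 (γ₀, y),
      (extChartAt IG (1 : G)).symm z.1 • (extChartAt I p).symm z.2 ∈ (extChartAt I p).source := by
    have hcs : Continuous (fun q : G × M ↦ q.1 • q.2) :=
      (ContMDiffSMul.contMDiff_smul (I := IG) (I' := I) (n := ∞) (G := G) (M := M)).continuous
    have hc : ContinuousAt (fun z : EG × EuclideanSpace ℝ (Fin n) ↦
        ((extChartAt IG (1 : G)).symm z.1, (extChartAt I p).symm z.2)) (γ₀, y) :=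
      (ContinuousAt.comp (g := (extChartAt IG (1 : G)).symm)
        (f := fun z : EG × EuclideanSpace ℝ (Fin n) ↦ z.1) (x := (γ₀, y))
        (continuousAt_extChartAt_symm (I := IG) (1 : G)) continuousAt_fst).prodMk
      (ContinuousAt.comp (g := (extChartAt I p).symm)
        (f := fun z : EG × EuclideanSpace ℝ (Fin n) ↦ z.2) (x := (γ₀, y))
        (continuousAt_extChartAt_symm'' (mem_of_mem_nhds hty)) continuousAt_snd)
    refine (ContinuousAt.comp (f := fun z : EG × EuclideanSpace ℝ (Fin n) ↦
      ((extChartAt IG (1 : G)).symm z.1, (extChartAt I p).symm z.2))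
      (g := fun q : G × M ↦ q.1 • q.2) hcs.continuousAt hc).eventually_mem ?_
    refine (isOpen_extChartAt_source p).mem_nhds ?_
    simp only [Function.comp_apply, γ₀, extChartAt_to_inv, one_smul]
    exact (extChartAt I p).map_target (mem_of_mem_nhds hty)
  have heq : (U ∘ actionInChart I IG G p) =ᶠ[𝓝 (γ₀, y)] fun z ↦ U z.2 := by
    filter_upwards [hsrc, (continuousAt_snd (p := (γ₀, y))).eventually_mem hSy]
      with z hz hzS
    simp only [hU, Function.comp_apply, actionInChart]
    rw [(extChartAt I p).left_inv hz, hu _ _ hzS]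
  have h3 := DFunLike.congr_fun ((h2.congr_of_eventuallyEq heq).unique h1) (ξ, 0)
  simpa [fundamentalField] using h3.symm

/-- The fundamental fields at `p` span the tangent space of the orbit: the differential at `1` of
the orbit map, read in charts, is the partial derivative of the action. -/
lemma mem_orbitTangent_iff
    {p : M} (hp : I.IsInteriorPoint p) (v : EuclideanSpace ℝ (Fin n)) :
    v ∈ (orbitTangent I IG G p : Submodule ℝ (EuclideanSpace ℝ (Fin n))) ↔
      ∃ ξ, fundamentalField I IG G p (extChartAt I p p) ξ = v := by
  have hsmooth : ContMDiff IG I ∞ (fun g : G ↦ g • p) :=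
    (ContMDiffSMul.contMDiff_smul (I := IG) (I' := I) (n := ∞) (G := G) (M := M)).comp
      (contMDiff_id.prodMk contMDiff_const)
  have hmd := (hsmooth.mdifferentiable (by norm_num)) (1 : G)
  have ha := (contDiffAt_actionInChart I IG G
    (extChartAt_target_mem_nhds_of_isInteriorPoint I hp)).differentiableAt
      (by norm_num) |>.hasFDerivAt
  have hder : (mfderiv IG I (fun g : G ↦ g • p) 1 : EG →L[ℝ] EuclideanSpace ℝ (Fin n)) =
      fundamentalField I IG G p (extChartAt I p p) := by
    rw [hmd.mfderiv]
    have h1 := ha.comp (extChartAt IG (1 : G) 1)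
      ((hasFDerivAt_id (𝕜 := ℝ) (extChartAt IG (1 : G) 1)).prodMk
        (hasFDerivAt_const (extChartAt I p p) (extChartAt IG (1 : G) 1)))
    rw [IG.range_eq_univ, fderivWithin_univ]
    have h2 : writtenInExtChartAt IG I (1 : G) (fun g : G ↦ g • p) =
        actionInChart I IG G p ∘ fun γ ↦ (γ, extChartAt I p p) := by
      funext γ
      simp only [writtenInExtChartAt, Function.comp_apply, actionInChart, extChartAt_to_inv,
        one_smul]
    rw [h2]
    exact h1.fderiv.trans rfl
  have horb := eqRec_tangentSubmodule I (one_smul G p)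
    (LinearMap.range (mfderiv IG I (fun g : G ↦ g • p) 1).toLinearMap)
  constructor
  · intro hv
    have hv' : v ∈ (one_smul G p ▸ LinearMap.range (mfderiv IG I (fun g : G ↦ g • p) 1).toLinearMap :
      Submodule ℝ (TangentSpace I p)) := hv
    rw [horb] at hv'
    obtain ⟨ξ, h⟩ := hv'
    exact ⟨ξ, (DFunLike.congr_fun hder ξ).symm.trans h⟩
  · rintro ⟨ξ, h⟩
    have hv' : v ∈ (one_smul G p ▸ LinearMap.range (mfderiv IG I (fun g : G ↦ g • p) 1).toLinearMap :
      Submodule ℝ (TangentSpace I p)) := by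
      rw [horb]
      exact ⟨ξ, (DFunLike.congr_fun hder ξ).trans h⟩
    exact hv'

end Action

/-! ### Unique continuation along the section -/

/-- The image of a vector spanning `F` spans a line complementary to `S`. -/
lemma exists_complement_line {F T : Type*} [AddCommGroup F] [Module ℝ F] [AddCommGroup T]
    [Module ℝ T] (hF : Module.finrank ℝ F = 1) (D : F →ₗ[ℝ] T) (hD : Function.Injective D)
    {S : Submodule ℝ T} (h : IsCompl (LinearMap.range D) S) :
    ∃ v₀ : T, v₀ ∉ S ∧ ∀ v, ∃ c : ℝ, ∃ w ∈ S, v = c • v₀ + w := by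
  obtain ⟨e, he, hspan⟩ := finrank_eq_one_iff'.1 hF
  refine ⟨D e, fun hS ↦ he (hD ?_), fun v ↦ ?_⟩
  · rw [map_zero]
    exact Submodule.disjoint_def.1 h.disjoint _ ⟨e, rfl⟩ hS
  · have hv : v ∈ LinearMap.range D ⊔ S := h.sup_eq_top ▸ Submodule.mem_top
    obtain ⟨_, ⟨z, rfl⟩, w, hw, rfl⟩ := Submodule.mem_sup.1 hv
    obtain ⟨c, rfl⟩ := hspan z
    exact ⟨c, w, hw, by rw [map_smul]⟩

section Uniqueness

variable {n : ℕ} {H : Type*} [TopologicalSpace H]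
  {I : ModelWithCorners ℝ (EuclideanSpace ℝ (Fin n)) H}

section Chart

variable {M : Type*} [TopologicalSpace M] [ChartedSpace H M]

lemma isInteriorPoint_of_mem_nonfixedInterior {G : Type*} [Group G] [MulAction G M] {p : M}
    (hp : p ∈ nonfixedInterior I G) : I.IsInteriorPoint p :=
  (I.isInteriorPoint_iff_not_isBoundaryPoint p).2 hp.2

lemma contDiffAt_comp_extChartAt_symm [IsManifold I ∞ M] {u : M → ℝ} {p : M}
    (hp : I.IsInteriorPoint p) (hu : ContMDiffAt I 𝓘(ℝ, ℝ) 2 u p) :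
    ContDiffAt ℝ 2 (u ∘ (extChartAt I p).symm) (extChartAt I p p) := by
  have : IsManifold I 2 M := IsManifold.of_le (n := ∞) ENat.LEInfty.out
  refine contMDiffAt_iff_contDiffAt.1 (ContMDiffAt.comp_of_eq (y := p) hu ?_ (by simp))
  exact (contMDiffOn_extChartAt_symm p).contMDiffAt
    (extChartAt_target_mem_nhds_of_isInteriorPoint I hp)

lemma fderiv_comp_extChartAt_symm {u : M → ℝ} {p : M} (hp : I.IsInteriorPoint p)
    (hu : MDifferentiableAt I 𝓘(ℝ, ℝ) u p) :
    fderiv ℝ (u ∘ (extChartAt I p).symm) (extChartAt I p p) = mfderiv I 𝓘(ℝ, ℝ) u p := by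
  rw [hu.mfderiv, fderivWithin_of_mem_nhds (range_mem_nhds_isInteriorPoint hp)]
  rfl

lemma riemannianGradient_injective [RiemannianBundle (fun x : M ↦ TangentSpace I x)]
    {u₁ u₂ : M → ℝ} {x : M}
    (h : riemannianGradient I u₁ x = riemannianGradient I u₂ x) :
    mfderiv I 𝓘(ℝ, ℝ) u₁ x = mfderiv I 𝓘(ℝ, ℝ) u₂ x := by
  have : FiniteDimensional ℝ (TangentSpace I x) :=
    inferInstanceAs (FiniteDimensional ℝ (EuclideanSpace ℝ (Fin n)))
  have : CompleteSpace (TangentSpace I x) := FiniteDimensional.complete ℝ _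
  exact (InnerProductSpace.toDual ℝ (TangentSpace I x)).symm.injective h

end Chart

variable {M : Type*} [EMetricSpace M] [ChartedSpace H M] [IsManifold I ∞ M]
  [RiemannianBundle (fun x : M ↦ TangentSpace I x)]
  [IsContMDiffRiemannianBundle I ∞ (EuclideanSpace ℝ (Fin n)) (fun x : M ↦ TangentSpace I x)]
  {EG : Type*} [NormedAddCommGroup EG] [NormedSpace ℝ EG]
  {HG : Type*} [TopologicalSpace HG] {IG : ModelWithCorners ℝ EG HG} [IG.Boundaryless]
  {G : Type*} [Group G] [TopologicalSpace G] [ChartedSpace HG G] [IsManifold IG ∞ G]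
  [MulAction G M] [ContMDiffSMul IG I ∞ G M]
  {F : Type*} [NormedAddCommGroup F] [NormedSpace ℝ F]
  {K : Type*} [TopologicalSpace K] {J : ModelWithCorners ℝ F K}
  {N : Type*} [TopologicalSpace N] [ChartedSpace K N] {ι : N → M}

/-- Two maximal radial solutions with the same value and the same differential at a point of the
section agree near that point. -/
lemma eventually_eq_of_fderiv_eq (hF : Module.finrank ℝ F = 1) (hι : IsPolarAction I IG J G ι)
    {f : M → ℝ → ℝ} {u₁ u₂ : M → ℝ} (h₁ : IsMaximalRadialSolution I G f u₁)
    (h₂ : IsMaximalRadialSolution I G f u₂) {t : N} (ht : ι t ∈ nonfixedInterior I G)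
    {C : ℝ}
    (hf : ∀ᶠ x in 𝓝 (ι t), |f x (u₁ x) - f x (u₂ x)| ≤ C * |u₁ x - u₂ x|)
    (h0 : u₁ (ι t) = u₂ (ι t))
    (hd : fderiv ℝ ((u₁ - u₂) ∘ (extChartAt I (ι t)).symm) (extChartAt I (ι t) (ι t)) = 0) :
    ∀ᶠ x in 𝓝 (ι t), u₁ x = u₂ x := by
  set p := ι t with hp
  set y₀ := extChartAt I p p with hy₀
  set ψ := (extChartAt I p).symm with hψ
  have hpi := isInteriorPoint_of_mem_nonfixedInterior ht
  have hM₀ := hι.isOpen_nonfixed.mem_nhds ht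
  have htgt := extChartAt_target_mem_nhds_of_isInteriorPoint I hpi
  have hψc : ContinuousAt ψ y₀ := continuousAt_extChartAt_symm p
  have hψ0 : ψ y₀ = p := extChartAt_to_inv p
  have hψt : Tendsto ψ (𝓝 y₀) (𝓝 p) := by
    have := hψc.tendsto
    rwa [hψ0] at this
  have hU₁ := contDiffAt_comp_extChartAt_symm hpi (h₁.contMDiffOn.contMDiffAt hM₀)
  have hU₂ := contDiffAt_comp_extChartAt_symm hpi (h₂.contMDiffOn.contMDiffAt hM₀)
  have hWdef : (u₁ - u₂) ∘ ψ = u₁ ∘ ψ - u₂ ∘ ψ := rfl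
  have hW : ContDiffAt ℝ 2 ((u₁ - u₂) ∘ ψ) y₀ := hU₁.sub hU₂
  obtain ⟨v₀, hv₀, hspan⟩ := exists_complement_line (T := TangentSpace I p) hF
    (mfderiv J I ι t).toLinearMap (hι.immersion t) (hι.transversal t ht)
  have hpos : (Matrix.of fun k i ↦ divergenceCoeff I p i k y₀).PosDef := by
    have hg := posDef_metricMatrix I (mem_of_mem_nhds htgt)
    have heq : (Matrix.of fun k i ↦ divergenceCoeff I p i k y₀) =
        (√(metricMatrix I (chartAt H p) y₀).det • (metricMatrix I (chartAt H p) y₀)⁻¹).transpose :=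
      Matrix.ext fun k i ↦ mul_comm _ _
    rw [heq]
    exact (hg.inv.smul (Real.sqrt_pos.2 hg.det_pos)).transpose
  obtain ⟨Cσ, hCσ0, hCσ⟩ := exists_eventually_norm_le (x := y₀)
    (f := fun y ↦ √(metricMatrix I (chartAt H p) y).det)
    (contDiffAt_det (contDiffAt_metricMatrix I htgt)).continuousAt.sqrt
  have hL : ∀ᶠ y in 𝓝 y₀,
      |∑ k, ∑ i, (Matrix.of fun k i ↦ divergenceCoeff I p i k y) k i *
          fderiv ℝ (fderiv ℝ ((u₁ - u₂) ∘ ψ)) y ((EuclideanSpace.basisFun (Fin n) ℝ).toBasis k)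
            ((EuclideanSpace.basisFun (Fin n) ℝ).toBasis i) +
        ∑ i, (∑ k, fderiv ℝ (divergenceCoeff I p i k) y (EuclideanSpace.single k 1)) *
          fderiv ℝ ((u₁ - u₂) ∘ ψ) y ((EuclideanSpace.basisFun (Fin n) ℝ).toBasis i)| ≤
      Cσ * C * |((u₁ - u₂) ∘ ψ) y| := by
    have hdiff : ∀ᶠ y in 𝓝 y₀, fderiv ℝ ((u₁ - u₂) ∘ ψ) y =
        fderiv ℝ (u₁ ∘ ψ) y - fderiv ℝ (u₂ ∘ ψ) y := by
      filter_upwards [hU₁.eventually (by simp), hU₂.eventually (by simp)] with y hy₁ hy₂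
      rw [hWdef]
      exact fderiv_sub (hy₁.differentiableAt (by norm_num)) (hy₂.differentiableAt (by norm_num))
    filter_upwards [eventually_laplaceBeltrami_eq I htgt hU₁,
      eventually_laplaceBeltrami_eq I htgt hU₂, hdiff.eventually_nhds, htgt, hCσ,
      hψt.eventually hf, hψt.eventually hM₀, hU₁.eventually (by simp), hU₂.eventually (by simp)]
      with y hl₁ hl₂ hdy hty hσ hfy hMy hy₁ hy₂
    have hsrc : ψ y ∈ (chartAt H p).source := by
      rw [← extChartAt_source I]
      exact (extChartAt I p).map_target hty
    have hs₁ := h₁.solves _ (IsManifold.chart_mem_maximalAtlas p) (ψ y) ⟨hsrc, hMy⟩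
    have hs₂ := h₂.solves _ (IsManifold.chart_mem_maximalAtlas p) (ψ y) ⟨hsrc, hMy⟩
    rw [hl₁] at hs₁
    rw [hl₂] at hs₂
    set σ := √(metricMatrix I (chartAt H p) y).det with hσdef
    have hσ0 : 0 < σ := Real.sqrt_pos.2 (posDef_metricMatrix I hty).det_pos
    have hH : fderiv ℝ (fderiv ℝ ((u₁ - u₂) ∘ ψ)) y =
        fderiv ℝ (fderiv ℝ (u₁ ∘ ψ)) y - fderiv ℝ (fderiv ℝ (u₂ ∘ ψ)) y := by
      rw [EventuallyEq.fderiv_eq (f := fun z ↦ fderiv ℝ (u₁ ∘ ψ) z - fderiv ℝ (u₂ ∘ ψ) z) hdy]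
      exact fderiv_fun_sub
        ((hy₁.fderiv_right (m := 1) (by norm_num)).differentiableAt (by norm_num))
        ((hy₂.fderiv_right (m := 1) (by norm_num)).differentiableAt (by norm_num))
    rw [hH, hdy.self_of_nhds]
    simp only [OrthonormalBasis.coe_toBasis, EuclideanSpace.basisFun_apply, Matrix.of_apply,
      sub_apply, mul_sub, Finset.sum_sub_distrib]
    have e₁ := (inv_mul_eq_iff_eq_mul₀ hσ0.ne').1 (neg_add_eq_zero.1 hs₁)
    have e₂ := (inv_mul_eq_iff_eq_mul₀ hσ0.ne').1 (neg_add_eq_zero.1 hs₂)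
    rw [sub_add_sub_comm, e₁, e₂, ← mul_sub, abs_mul, mul_assoc]
    exact mul_le_mul hσ hfy (abs_nonneg _) hCσ0
  obtain ⟨C', hC'⟩ := exists_eventually_norm_hessian_le
    (EuclideanSpace.basisFun (Fin n) ℝ).toBasis (v₀ := v₀)
    (X := fundamentalField I IG G p)
    (a := fun y ↦ Matrix.of fun k i ↦ divergenceCoeff I p i k y)
    (b := fun i y ↦ ∑ k, fderiv ℝ (divergenceCoeff I p i k) y (EuclideanSpace.single k 1))
    hW (contDiffAt_fundamentalField I IG G htgt)
    (eventually_fderiv_fundamentalField_eq_zero I IG G htgt (u := u₁ - u₂)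
      (hψt hM₀) (fun g x hx ↦ by simp [h₁.radial g x hx, h₂.radial g x hx])
      (hW.of_le (by norm_num)))
    (fun v ↦ by
      obtain ⟨c, w, hw, hv⟩ := hspan v
      obtain ⟨ξ, rfl⟩ := (mem_orbitTangent_iff I IG G hpi w).1 hw
      exact ⟨c, ξ, hv⟩)
    (fun ξ hξ ↦ hv₀ ((mem_orbitTangent_iff I IG G hpi v₀).2 ⟨ξ, hξ⟩))
    (continuousAt_pi.2 fun k ↦ continuousAt_pi.2 fun i ↦
      (contDiffAt_divergenceCoeff I htgt i k).continuousAt)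
    hpos
    (fun i ↦ tendsto_finsetSum _ fun k _ ↦
      (((contDiffAt_divergenceCoeff I htgt i k).fderiv_right (m := 0)
        (by norm_num)).continuousAt.clm_apply continuousAt_const))
    hL
  have hzero := eventually_eq_zero_of_norm_hessian_le hW
    (by simp [hψ0, h0]) hd hC'
  filter_upwards [(continuousAt_extChartAt (I := I) p).eventually hzero,
    extChartAt_source_mem_nhds (I := I) p] with x hx hxs
  rw [Function.comp_apply, hψ, (extChartAt I p).left_inv hxs] at hx
  exact sub_eq_zero.1 hx

/-- Unique continuation along the section: the set of the points of the section near which two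
solutions agree is open and closed. -/
lemma eqOn_nonfixedInterior (hF : Module.finrank ℝ F = 1) (hι : IsPolarAction I IG J G ι)
    {f : M → ℝ → ℝ} {u₁ u₂ : M → ℝ} (h₁ : IsMaximalRadialSolution I G f u₁)
    (h₂ : IsMaximalRadialSolution I G f u₂)
    (hf : ∀ p ∈ nonfixedInterior (M := M) I G, ∃ C : ℝ,
      ∀ᶠ x in 𝓝 p, |f x (u₁ x) - f x (u₂ x)| ≤ C * |u₁ x - u₂ x|)
    (hex : ∃ t : N, ι t ∈ nonfixedInterior I G ∧ u₁ (ι t) = u₂ (ι t) ∧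
      riemannianGradient I u₁ (ι t) = riemannianGradient I u₂ (ι t)) :
    ∀ x ∈ nonfixedInterior (M := M) I G, u₁ x = u₂ x := by
  set O : Set M := {x | ∀ᶠ z in 𝓝 x, u₁ z = u₂ z} with hO
  have hOo : IsOpen O := isOpen_setOfPred_eventually_nhds
  have hιc : Continuous ι := hι.smooth.continuous
  have hcd : ∀ {u : M → ℝ}, IsMaximalRadialSolution I G f u → ∀ {p : M},
      p ∈ nonfixedInterior I G → ContMDiffAt I 𝓘(ℝ, ℝ) 2 u p := fun hu _ hp ↦
    hu.contMDiffOn.contMDiffAt (hι.isOpen_nonfixed.mem_nhds hp)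
  have hsub : ι ⁻¹' nonfixedInterior I G ⊆ ι ⁻¹' O := by
    refine hι.connected_section.isPreconnected.subset_of_closure_inter_subset
      (hOo.preimage hιc) ?_ ?_
    · obtain ⟨t, ht, h0, hgrad⟩ := hex
      obtain ⟨C, hfC⟩ := hf _ ht
      refine ⟨t, ht, eventually_eq_of_fderiv_eq hF hι h₁ h₂ ht hfC h0 ?_⟩
      have hpi := isInteriorPoint_of_mem_nonfixedInterior ht
      have hW : (u₁ - u₂) ∘ (extChartAt I (ι t)).symm =
        u₁ ∘ (extChartAt I (ι t)).symm - u₂ ∘ (extChartAt I (ι t)).symm := rfl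
      rw [hW, fderiv_sub
        ((contDiffAt_comp_extChartAt_symm hpi (hcd h₁ ht)).differentiableAt (by norm_num))
        ((contDiffAt_comp_extChartAt_symm hpi (hcd h₂ ht)).differentiableAt (by norm_num)),
        fderiv_comp_extChartAt_symm hpi ((hcd h₁ ht).mdifferentiableAt (by norm_num)),
        fderiv_comp_extChartAt_symm hpi ((hcd h₂ ht).mdifferentiableAt (by norm_num))]
      exact sub_eq_zero.2 (riemannianGradient_injective hgrad)
    · rintro t ⟨htcl, ht⟩
      obtain ⟨C, hfC⟩ := hf _ ht
      set p := ι t with hp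
      have hpi : I.IsInteriorPoint p := isInteriorPoint_of_mem_nonfixedInterior ht
      have hpcl : p ∈ closure O := hιc.closure_preimage_subset O htcl
      set y₀ := extChartAt I p p
      set W := (u₁ - u₂) ∘ (extChartAt I p).symm with hW
      have hWd : ContDiffAt ℝ 2 W y₀ :=
        (contDiffAt_comp_extChartAt_symm hpi (hcd h₁ ht)).sub
          (contDiffAt_comp_extChartAt_symm hpi (hcd h₂ ht))
      -- `W` and its derivative vanish at points arbitrarily close to `y₀`, hence at `y₀`
      have hfreq : ∃ᶠ y in 𝓝 y₀, W y = 0 ∧ fderiv ℝ W y = 0 := by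
        have h1 : ∃ᶠ x in 𝓝 p, x ∈ O ∧ x ∈ (extChartAt I p).source ∧
            extChartAt I p x ∈ interior (extChartAt I p).target := by
          refine (mem_closure_iff_frequently.1 hpcl).and_eventually ?_
          exact Filter.Eventually.and (extChartAt_source_mem_nhds (I := I) p)
            ((continuousAt_extChartAt (I := I) p).eventually
              (isOpen_interior.mem_nhds (mem_interior_iff_mem_nhds.2
                (extChartAt_target_mem_nhds_of_isInteriorPoint I hpi))))
        refine (continuousAt_extChartAt (I := I) p).tendsto.frequently (h1.mono ?_)
        rintro x ⟨hxO, hxs, hxt⟩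
        have hz : W =ᶠ[𝓝 (extChartAt I p x)] fun _ ↦ 0 := by
          have hc := continuousAt_extChartAt_symm'' (I := I) (x := p) (interior_subset hxt)
          have hl : (extChartAt I p).symm (extChartAt I p x) = x := (extChartAt I p).left_inv hxs
          rw [ContinuousAt, hl] at hc
          exact (hc.eventually hxO).mono fun z hz ↦ sub_eq_zero.2 hz
        exact ⟨hz.self_of_nhds, by rw [hz.fderiv_eq]; simp⟩
      have hW0 : W y₀ = 0 := by
        by_contra hne
        exact hfreq ((hWd.continuousAt.eventually_ne hne).mono fun y hy h ↦ hy h.1)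
      have hW1 : fderiv ℝ W y₀ = 0 := by
        by_contra hne
        exact hfreq (((hWd.fderiv_right (m := 1) (by norm_num)).continuousAt.eventually_ne
          hne).mono fun y hy h ↦ hy h.2)
      refine eventually_eq_of_fderiv_eq hF hι h₁ h₂ ht hfC ?_ hW1
      have : W y₀ = u₁ p - u₂ p := by simp [hW, y₀]
      rw [this] at hW0
      exact sub_eq_zero.1 hW0
  intro x hx
  obtain ⟨t, ht, g, rfl⟩ := hι.meets_orbits x hx
  rw [h₁.radial g _ ht, h₂.radial g _ ht]
  exact (hsub ht : ∀ᶠ z in 𝓝 (ι t), u₁ z = u₂ z).self_of_nhds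

end Uniqueness

/-! ### The nonlinearity and the zero solution -/

/-- On a compact neighbourhood the graphs of two continuous functions are compact, so that a
locally Lipschitz nonlinearity is Lipschitz between them. -/
lemma LocallyLipschitzInSnd.exists_eventually_le {X : Type*} [TopologicalSpace X]
    [LocallyCompactSpace X] {f : X → ℝ → ℝ} {D : Set (X × ℝ)} (hf : LocallyLipschitzInSnd f D)
    {U : Set X} (hU : IsOpen U) {u₁ u₂ : X → ℝ} (h₁ : ContinuousOn u₁ U) (h₂ : ContinuousOn u₂ U)
    (hD₁ : ∀ x ∈ U, (x, u₁ x) ∈ D) (hD₂ : ∀ x ∈ U, (x, u₂ x) ∈ D) {p : X} (hp : p ∈ U) :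
    ∃ C : ℝ, ∀ᶠ x in 𝓝 p, |f x (u₁ x) - f x (u₂ x)| ≤ C * |u₁ x - u₂ x| := by
  obtain ⟨K, hKp, hKU, hK⟩ := local_compact_nhds (hU.mem_nhds hp)
  obtain ⟨C, -, h⟩ := hf ((fun x ↦ (x, u₁ x)) '' K ∪ (fun x ↦ (x, u₂ x)) '' K)
    ((hK.image_of_continuousOn (continuousOn_id.prodMk (h₁.mono hKU))).union
      (hK.image_of_continuousOn (continuousOn_id.prodMk (h₂.mono hKU))))
    (union_subset (image_subset_iff.2 fun x hx ↦ hD₁ x (hKU hx))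
      (image_subset_iff.2 fun x hx ↦ hD₂ x (hKU hx)))
  exact ⟨C, mem_of_superset hKp fun x hx ↦
    h x _ _ (Or.inl ⟨x, hx, rfl⟩) (Or.inr ⟨x, hx, rfl⟩)⟩

lemma isMaximalRadialSolution_zero {n : ℕ} {H : Type*} [TopologicalSpace H]
    (I : ModelWithCorners ℝ (EuclideanSpace ℝ (Fin n)) H)
    {M : Type*} [TopologicalSpace M] [ChartedSpace H M]
    [RiemannianBundle (fun x : M ↦ TangentSpace I x)] (G : Type*) [Group G] [MulAction G M]
    {f : M → ℝ → ℝ} (hf : ∀ x, f x 0 = 0) : IsMaximalRadialSolution I G f fun _ ↦ 0 where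
  contMDiffOn := contMDiffOn_const
  radial _ _ _ := rfl
  solves e _ x _ := by
    simp [hf, laplaceBeltrami, partialDeriv, Function.comp_def]

end PolarPDE

end

open PolarPDE in
theorem theorem2 {n : ℕ}
    -- the connected Riemannian manifold `M`, of dimension `n`, possibly with boundary
    {H : Type*} [TopologicalSpace H] (I : ModelWithCorners ℝ (EuclideanSpace ℝ (Fin n)) H)
    {M : Type*} [EMetricSpace M] [ConnectedSpace M] [ChartedSpace H M] [IsManifold I ∞ M]
    [RiemannianBundle (fun x : M ↦ TangentSpace I x)]
    [IsContMDiffRiemannianBundle I ∞ (EuclideanSpace ℝ (Fin n)) (fun x : M ↦ TangentSpace I x)]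
    [IsRiemannianManifold I M]
    -- the unimodular Lie group `G`, acting smoothly on `M`
    {EG : Type*} [NormedAddCommGroup EG] [NormedSpace ℝ EG] [FiniteDimensional ℝ EG]
    {HG : Type*} [TopologicalSpace HG] (IG : ModelWithCorners ℝ EG HG) [IG.Boundaryless]
    (G : Type*) [Group G] [TopologicalSpace G] [T2Space G] [SecondCountableTopology G]
    [ChartedSpace HG G] [LieGroup IG ∞ G] [MulAction G M] [ContMDiffSMul IG I ∞ G M]
    (hG : IsUnimodular G)
    -- the one-dimensional connected submanifold, parameterized by `ι : N → M`
    {F : Type*} [NormedAddCommGroup F] [NormedSpace ℝ F] (hF : Module.finrank ℝ F = 1)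
    {K : Type*} [TopologicalSpace K] (J : ModelWithCorners ℝ F K)
    {N : Type*} [TopologicalSpace N] [ConnectedSpace N] [ChartedSpace K N] [IsManifold J ∞ N]
    (ι : N → M) (hι : IsPolarAction I IG J G ι) :
    -- (i)
    (∀ f : M → ℝ → ℝ, Continuous (Function.uncurry f) → RadialInFst G f univ →
      LocallyLipschitzInSnd f univ →
      ∀ u₁ u₂ : M → ℝ, IsMaximalRadialSolution I G f u₁ → IsMaximalRadialSolution I G f u₂ →
      (∃ t : N, ι t ∈ nonfixedInterior I G ∧
        u₁ (ι t) = u₂ (ι t) ∧ riemannianGradient I u₁ (ι t) = riemannianGradient I u₂ (ι t)) →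
      ∀ x ∈ nonfixedInterior (M := M) I G, u₁ x = u₂ x) ∧
    -- (ii)
    (∀ f : M → ℝ → ℝ, Continuous (Function.uncurry f) → RadialInFst G f univ →
      LocallyLipschitzInSnd f univ → (∀ x, f x 0 = 0) →
      ∀ u : M → ℝ, IsMaximalRadialSolution I G f u →
      (∃ t : N, ι t ∈ nonfixedInterior I G ∧ u (ι t) = 0 ∧ riemannianGradient I u (ι t) = 0) →
      ∀ x ∈ nonfixedInterior (M := M) I G, u x = 0) ∧
    -- (iii), where only the values `f x y` with `y > 0` matter
    (∀ f : M → ℝ → ℝ, ContinuousOn (Function.uncurry f) (univ ×ˢ Ioi 0) →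
      RadialInFst G f (Ioi 0) → LocallyLipschitzInSnd f (univ ×ˢ Ioi 0) →
      ∀ u₁ u₂ : M → ℝ, IsMaximalRadialSolution I G f u₁ → IsMaximalRadialSolution I G f u₂ →
      (∀ x ∈ nonfixedInterior (M := M) I G, 0 < u₁ x) →
      (∀ x ∈ nonfixedInterior (M := M) I G, 0 < u₂ x) →
      (∃ t : N, ι t ∈ nonfixedInterior I G ∧
        u₁ (ι t) = u₂ (ι t) ∧ riemannianGradient I u₁ (ι t) = riemannianGradient I u₂ (ι t)) →
      ∀ x ∈ nonfixedInterior (M := M) I G, u₁ x = u₂ x) := by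

  have : LocallyCompactSpace H := I.locallyCompactSpace
  have : LocallyCompactSpace M := ChartedSpace.locallyCompactSpace H M
  have hi : ∀ f : M → ℝ → ℝ, LocallyLipschitzInSnd f univ →
      ∀ u₁ u₂ : M → ℝ, IsMaximalRadialSolution I G f u₁ → IsMaximalRadialSolution I G f u₂ →
      (∃ t : N, ι t ∈ nonfixedInterior I G ∧
        u₁ (ι t) = u₂ (ι t) ∧ riemannianGradient I u₁ (ι t) = riemannianGradient I u₂ (ι t)) →
      ∀ x ∈ nonfixedInterior (M := M) I G, u₁ x = u₂ x := fun f hL u₁ u₂ h₁ h₂ ↦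
    eqOn_nonfixedInterior hF hι h₁ h₂ fun p hp ↦
      hL.exists_eventually_le hι.isOpen_nonfixed h₁.contMDiffOn.continuousOn
        h₂.contMDiffOn.continuousOn (fun _ _ ↦ mem_univ _) (fun _ _ ↦ mem_univ _) hp
  refine ⟨fun f _ _ hL ↦ hi f hL, fun f _ _ hL hf0 u hu ⟨t, ht, h0, h1⟩ ↦ ?_,
    fun f _ _ hL u₁ u₂ h₁ h₂ hp₁ hp₂ ↦ ?_⟩
  · refine hi f hL u (fun _ ↦ 0) hu (isMaximalRadialSolution_zero I G hf0) ⟨t, ht, h0, ?_⟩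
    rw [h1, riemannianGradient, mfderiv_const]
    exact (map_zero _).symm
  · exact eqOn_nonfixedInterior hF hι h₁ h₂ fun p hp ↦
      hL.exists_eventually_le hι.isOpen_nonfixed h₁.contMDiffOn.continuousOn
        h₂.contMDiffOn.continuousOn (fun x hx ↦ ⟨mem_univ _, hp₁ x hx⟩)
        (fun x hx ↦ ⟨mem_univ _, hp₂ x hx⟩) hp
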